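/- A pointed linearly ordered set is a linearly ordered set $L$ with a distinguished element $1\in L$; put $L_-=\{x\in L:x<1\}$ and $L_+=\{x\in L:x>1\}$. A morphism of pointed linearly ordered sets is a monotone map $f$ with $f(1)=1$. Let $FS_L$ be the free semigroup of non-empty words over $L$, and let $\preceq$ be the smallest preorder on $FS_L$ that is compatible with multiplication, extends the order of $L$ (identified with the set of one-letter words), and contains the pairs $(x,x1)$, $(x1,x)$, $(x,1x)$, $(1x,x)$, $(x,xx)$, $(xx,x)$ for all $x\in L$. The free Kuratowski monoid $FK_L$ is the quotient of $FS_L$ by the congruence $\{(v,w):v\preceq w,\ w\preceq v\}$, with the quotient partial order; it is a partially ordered monoid, whose unit is the class of the word $1$. Every morphism $f:L\to\Lambda$ induces a monotone monoid homomorphism $\bar f:FK_L\to FK_\Lambda$, applying $f$ letter by letter. For $n,p\in\mathbb N$ let $L_{n,p}$ be a pointed linearly ordered set with $|(L_{n,p})_-|=n$ and $|(L_{n,p})_+|=p$, and let $FK_{n,p}=FK_{L_{n,p}}$. **Proposition.** Let $L$ be any pointed linearly ordered set. 1. For any distinct $x,y\in FK_L$ there are a pair $(n,p)\in\{(1,2),(2,1)\}$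 and a morphism $f:L\to L_{n,p}$ with $\bar f(x)\neq\bar f(y)$. 2. $FK_L$ embeds, as a partially ordered monoid, into some power of the partially ordered monoid $FK_{1,2}\times FK_{2,1}$: there are a set $I$ and an injective monoid homomorphism $\Phi:FK_L\to(FK_{1,2}\times FK_{2,1})^I$ such that $\Phi(x)\le\Phi(y)\iff x\le y$ for all $x,y\in FK_L$ (products and powers carry the componentwise operation and order). 3. For any distinct $x,y\in FK_L$ there is a morphism $f:L\to L_{2,2}$ with $\bar f(x)\neq\bar f(y)$. 4. $FK_L$ embeds, in the same sense, into some power of $FK_{2,2}$. -/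

import Mathlib

universe u v

/-! A pointed linearly ordered set is a type `L` with `[LinearOrder L] [One L]`: the unit is `1 : L`,
the negative part is `{x | x < 1}` and the positive part is `{x | 1 < x}`. -/

/-- A morphism of pointed linearly ordered sets: a monotone map preserving the unit. -/
structure PointedHom (L : Type u) (M : Type v) [LinearOrder L] [One L] [LinearOrder M] [One M] where
  toFun : L → M
  monotone' : Monotone toFun
  map_one' : toFun 1 = 1

/-- `HasType L n p`: the pointed linearly ordered set `L` is an `L_{n,p}`, that is, it has exactly
`n` negative and exactly `p` positive elements. -/
def HasType (L : Type u) [LinearOrder L] [One L] (n p : ℕ) : Prop :=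
  {x : L | x < 1}.encard = n ∧ {x : L | 1 < x}.encard = p

namespace FK

/-- The smallest compatible preorder on the free semigroup over `L` (nonempty words) that extends
the order of `L` and contains `(x, x1)`, `(x, 1x)`, `(x1, x)`, `(1x, x)`, `(x, xx)`, `(xx, x)` for
all letters `x`. -/
inductive WordLE (L : Type u) [LinearOrder L] [One L] :
    FreeSemigroup L → FreeSemigroup L → Prop
  | of_le {x y : L} (h : x ≤ y) : WordLE L (.of x) (.of y)
  | le_mul_one (x : L) : WordLE L (.of x) (.of x * .of 1)
  | le_one_mul (x : L) : WordLE L (.of x) (.of 1 * .of x)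
  | mul_one_le (x : L) : WordLE L (.of x * .of 1) (.of x)
  | one_mul_le (x : L) : WordLE L (.of 1 * .of x) (.of x)
  | le_sq (x : L) : WordLE L (.of x) (.of x * .of x)
  | sq_le (x : L) : WordLE L (.of x * .of x) (.of x)
  | refl (a : FreeSemigroup L) : WordLE L a a
  | trans {a b c : FreeSemigroup L} : WordLE L a b → WordLE L b c → WordLE L a c
  | mul_right {a b : FreeSemigroup L} (c : FreeSemigroup L) :
      WordLE L a b → WordLE L (a * c) (b * c)
  | mul_left {a b : FreeSemigroup L} (c : FreeSemigroup L) :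
      WordLE L a b → WordLE L (c * a) (c * b)

/-- The congruence on the free semigroup generated by the preorder `WordLE`. -/
def con (L : Type u) [LinearOrder L] [One L] : Con (FreeSemigroup L) where
  r a b := WordLE L a b ∧ WordLE L b a
  iseqv := ⟨fun a => ⟨.refl a, .refl a⟩, fun h => ⟨h.2, h.1⟩,
    fun h k => ⟨h.1.trans k.1, k.2.trans h.2⟩⟩
  mul' {_ _ _ _} h k :=
    ⟨(h.1.mul_right _).trans (k.1.mul_left _), (h.2.mul_right _).trans (k.2.mul_left _)⟩

end FK

/-- The free Kuratowski monoid generated by the pointed linearly ordered set `L`. -/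
def FK (L : Type u) [LinearOrder L] [One L] : Type u := (FK.con L).Quotient

namespace FK

section
variable {L : Type u} [LinearOrder L] [One L]

/-- The quotient map from words to the free Kuratowski monoid. -/
def mk (w : FreeSemigroup L) : FK L := Quotient.mk (con L).toSetoid w

/-- The canonical map `L → FK L`. -/
def ι (x : L) : FK L := mk (.of x)

theorem mk_eq_mk {a b : FreeSemigroup L} : mk a = mk b ↔ WordLE L a b ∧ WordLE L b a :=
  ⟨fun h => Quotient.exact h, fun h => Quotient.sound h⟩

theorem wordLE_of_mul_one (a : FreeSemigroup L) :
    mk (a * .of 1) = mk a ∧ mk (.of 1 * a) = mk a := by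
  induction a using FreeSemigroup.recOnMul with
  | ih1 x => exact ⟨mk_eq_mk.2 ⟨.mul_one_le x, .le_mul_one x⟩,
      mk_eq_mk.2 ⟨.one_mul_le x, .le_one_mul x⟩⟩
  | ih2 x y hx hy =>
    refine ⟨?_, ?_⟩
    · rw [mul_assoc]
      have h := mk_eq_mk.1 hy.1
      exact mk_eq_mk.2 ⟨h.1.mul_left _, h.2.mul_left _⟩
    · rw [← mul_assoc]
      have h := mk_eq_mk.1 hx.2
      exact mk_eq_mk.2 ⟨h.1.mul_right _, h.2.mul_right _⟩

/-- The multiplication is induced by concatenation of words; the unit is the class of the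
one-letter word `1`. -/
instance : Monoid (FK L) where
  mul a b := Quotient.map₂ (· * ·) (fun _ _ h _ _ k => (con L).mul h k) a b
  mul_assoc a b c := by
    induction a using Quotient.inductionOn with | h a => ?_
    induction b using Quotient.inductionOn with | h b => ?_
    induction c using Quotient.inductionOn with | h c => ?_
    exact congrArg mk (mul_assoc a b c)
  one := ι 1
  mul_one a := by
    induction a using Quotient.inductionOn with | h a => exact (wordLE_of_mul_one a).1
  one_mul a := by
    induction a using Quotient.inductionOn with | h a => exact (wordLE_of_mul_one a).2

/-- The quotient partial order. -/
instance : PartialOrder (FK L) where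
  le a b := Quotient.liftOn₂ a b (WordLE L) (fun _ _ _ _ h k =>
    propext ⟨fun e => (h.2.trans e).trans k.1, fun e => (h.1.trans e).trans k.2⟩)
  le_refl a := by
    induction a using Quotient.inductionOn with | h a => exact WordLE.refl a
  le_trans a b c := by
    induction a using Quotient.inductionOn with | h a => ?_
    induction b using Quotient.inductionOn with | h b => ?_
    induction c using Quotient.inductionOn with | h c => ?_
    exact fun h k => WordLE.trans h k
  le_antisymm a b := by
    induction a using Quotient.inductionOn with | h a => ?_
    induction b using Quotient.inductionOn with | h b => ?_
    exact fun h k => mk_eq_mk.2 ⟨h, k⟩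

theorem mk_le_mk {a b : FreeSemigroup L} : mk a ≤ mk b ↔ WordLE L a b := Iff.rfl

theorem mk_mul (a b : FreeSemigroup L) : mk (a * b) = mk a * mk b := rfl

theorem mul_le_mul_both {a b c d : FK L} (h : a ≤ b) (k : c ≤ d) : a * c ≤ b * d := by
  induction a using Quotient.inductionOn with | h a => ?_
  induction b using Quotient.inductionOn with | h b => ?_
  induction c using Quotient.inductionOn with | h c => ?_
  induction d using Quotient.inductionOn with | h d => ?_
  exact (WordLE.mul_right c h).trans (WordLE.mul_left b k)

theorem ι_one : ι (1 : L) = 1 := rfl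

end

section
variable {L : Type u} {M : Type v} [LinearOrder L] [One L] [LinearOrder M] [One M]

theorem wordLE_map (f : PointedHom L M) {a b : FreeSemigroup L} (h : WordLE L a b) :
    WordLE M (FreeSemigroup.map f.toFun a) (FreeSemigroup.map f.toFun b) := by
  induction h with
  | of_le h => exact .of_le (f.monotone' h)
  | le_mul_one x => simpa [f.map_one'] using WordLE.le_mul_one (f.toFun x)
  | le_one_mul x => simpa [f.map_one'] using WordLE.le_one_mul (f.toFun x)
  | mul_one_le x => simpa [f.map_one'] using WordLE.mul_one_le (f.toFun x)
  | one_mul_le x => simpa [f.map_one'] using WordLE.one_mul_le (f.toFun x)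
  | le_sq x => simpa using WordLE.le_sq (f.toFun x)
  | sq_le x => simpa using WordLE.sq_le (f.toFun x)
  | refl a => exact .refl _
  | trans _ _ ih ih' => exact ih.trans ih'
  | mul_right c _ ih => simpa using ih.mul_right (FreeSemigroup.map f.toFun c)
  | mul_left c _ ih => simpa using ih.mul_left (FreeSemigroup.map f.toFun c)

/-- The homomorphism `FK L → FK M` induced by a morphism `f : L → M`, applying `f` letterwise. -/
def map (f : PointedHom L M) : FK L →* FK M where
  toFun := Quotient.map (FreeSemigroup.map f.toFun)
    (fun _ _ h => ⟨wordLE_map f h.1, wordLE_map f h.2⟩)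
  map_one' := congrArg ι f.map_one'
  map_mul' a b := by
    induction a using Quotient.inductionOn with | h a => ?_
    induction b using Quotient.inductionOn with | h b => ?_
    exact congrArg mk (map_mul (FreeSemigroup.map f.toFun) a b)

theorem map_ι (f : PointedHom L M) (x : L) : map f (ι x) = ι (f.toFun x) := rfl

/-- `map f` is the only multiplicative map extending `f`. -/
theorem map_unique (f : PointedHom L M) (g : FK L →ₙ* FK M)
    (hg : ∀ x, g (ι x) = ι (f.toFun x)) (a : FK L) : g a = map f a := by
  induction a using Quotient.inductionOn with | h a => ?_
  change g (mk a) = map f (mk a)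
  induction a using FreeSemigroup.recOnMul with
  | ih1 x => exact hg x
  | ih2 x y hx hy => rw [mk_mul, map_mul, _root_.map_mul, hx, hy]

theorem map_monotone (f : PointedHom L M) : Monotone (map f) := by
  intro a b
  induction a using Quotient.inductionOn with | h a => ?_
  induction b using Quotient.inductionOn with | h b => ?_
  exact fun h => wordLE_map f h

end

end FK

/-! The order of `FK L` is detected by coarse data: for every pointed monotone map from `L` to the
signs, the first and last nonzero sign of a word and which signs occur in it. The generating
inequalities respect these data (`FK.signLE_of_wordLE`). The converse, `WordOrder.le_of_signLE`,
carries the proof. Since the signs form a copy of `L_{1,1}`, they sit inside every target having a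
negative and a positive element, so `FK.le_of_forall_map_le` yields all four claims; separation by
`(1,2)` alone already suffices.

The converse goes by induction on total length, which allows both words to be taken reduced. Reduced
words alternate in sign, and once they start to narrow towards `1` they go on narrowing
(`WordOrder.isReduced_narrow`). If the smaller word has a positive end, or the larger a negative
one, that letter is stripped. Otherwise the words are scanned from both ends: either induction
applies, or one word narrows from the left. A word cannot narrow from both ends, which leaves bounds
placing a two-letter word between the two. -/

/-- The first nonzero sign in a list of signs, or `0` if there is none. -/
def firstSign : List SignType → SignType
  | [] => 0
  | a :: l => if a = 0 then firstSign l else a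

theorem firstSign_append (l k : List SignType) :
    firstSign (l ++ k) = if firstSign l = 0 then firstSign k else firstSign l := by
  induction l with
  | nil => simp [firstSign]
  | cons a l ih =>
    by_cases ha : a = 0 <;> simp [firstSign, ha, ih]

theorem firstSign_append_mono {l l' k k' : List SignType} (h : firstSign l ≤ firstSign l')
    (h' : firstSign k ≤ firstSign k') : firstSign (l ++ k) ≤ firstSign (l' ++ k') := by
  rw [firstSign_append, firstSign_append]
  generalize firstSign l = a at *
  generalize firstSign l' = b at *
  generalize firstSign k = c at *
  generalize firstSign k' = d at *
  revert a b c d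
  decide

theorem firstSign_map_neg (l : List SignType) :
    firstSign (l.map (fun a => -a)) = -firstSign l := by
  induction l with
  | nil => rfl
  | cons a l ih =>
    rw [List.map_cons, firstSign, firstSign, ih]
    cases a <;> rfl

/-- The sign of a letter relative to the interval `[s, t]`. -/
def intervalSign {L : Type*} [LinearOrder L] (s t x : L) : SignType := if x < s then -1 else if t < x then 1 else 0

theorem intervalSign_monotone {L : Type*} [LinearOrder L] {s t : L} (hs : s ≤ t) : Monotone (intervalSign s t) := by
  intro x y hxy
  unfold intervalSign
  split_ifs <;> first | decide | (exfalso; grind)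

/-- A word is reduced if it is not equivalent to a shorter word. -/
def IsReducedWord {L : Type*} (R : List L → List L → Prop) (w : List L) : Prop :=
  ∀ w', R w w' → R w' w → w.length ≤ w'.length

theorem IsReducedWord.reverse {L : Type*} {R : List L → List L → Prop} {w : List L} (h : IsReducedWord R w) :
    IsReducedWord (fun w v : List L => R w.reverse v.reverse) w.reverse := by
  intro w' h1 h2
  have := h w'.reverse (by simpa using h1) (by simpa using h2)
  simpa using this

theorem IsReducedWord.dual {L : Type*} {R : List L → List L → Prop} {w : List L} (h : IsReducedWord R w) :
    IsReducedWord (L := Lᵒᵈ) (fun w v => R v w) w :=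
  fun w' h1 h2 => h w' h2 h1


/-! ### Comparison of words by signs, and its symmetries -/

section WordOrder

variable {L : Type*} [LinearOrder L] [One L]

/-- Comparison of words by signs: for each pointed monotone map `g` to the signs, compare
the first signs, the last signs, and the presence of negative and of positive signs. -/
def SignLE (w v : List L) : Prop :=
  ∀ g : L → SignType, Monotone g → g 1 = 0 →
    firstSign (w.map g) ≤ firstSign (v.map g) ∧
    firstSign (w.reverse.map g) ≤ firstSign (v.reverse.map g) ∧
    ((∀ x ∈ w, 0 ≤ g x) → ∀ x ∈ v, 0 ≤ g x) ∧
    ((∀ x ∈ v, g x ≤ 0) → ∀ x ∈ w, g x ≤ 0)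

theorem SignLE.refl (w : List L) : SignLE w w :=
  fun _ _ _ => ⟨le_rfl, le_rfl, id, id⟩

theorem SignLE.trans {u v w : List L} (h : SignLE u v) (k : SignLE v w) : SignLE u w :=
  fun g hg h1 =>
    have a := h g hg h1
    have b := k g hg h1
    ⟨a.1.trans b.1, a.2.1.trans b.2.1, b.2.2.1 ∘ a.2.2.1, a.2.2.2 ∘ b.2.2.2⟩

theorem SignLE.append {w w' v v' : List L} (h : SignLE w w') (k : SignLE v v') :
    SignLE (w ++ v) (w' ++ v') := by
  intro g hg h1
  obtain ⟨a1, a2, a3, a4⟩ := h g hg h1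
  obtain ⟨b1, b2, b3, b4⟩ := k g hg h1
  refine ⟨?_, ?_, ?_, ?_⟩
  · simpa using firstSign_append_mono a1 b1
  · simpa using firstSign_append_mono b2 a2
  · intro H x hx
    rcases List.mem_append.1 hx with hx | hx
    · exact a3 (fun y hy => H y (List.mem_append_left _ hy)) x hx
    · exact b3 (fun y hy => H y (List.mem_append_right _ hy)) x hx
  · intro H x hx
    rcases List.mem_append.1 hx with hx | hx
    · exact a4 (fun y hy => H y (List.mem_append_left _ hy)) x hx
    · exact b4 (fun y hy => H y (List.mem_append_right _ hy)) x hx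

theorem SignLE.reverse {w v : List L} (h : SignLE w v) : SignLE w.reverse v.reverse :=
  fun g hg h1 => by simpa [and_left_comm] using h g hg h1

/-- Composing a test map with negation turns it into one for the reversed order and swaps the last
two clauses. With reversal of words, this lets each later argument be given for one sign and one end
only. -/
theorem SignLE.dual {w v : List L} (h : SignLE w v) : SignLE (L := Lᵒᵈ) v w := by
  intro g hg h1
  obtain ⟨a1, a2, a3, a4⟩ := h (fun x => -g (OrderDual.toDual x))
    (fun x y hxy => SignType.neg_le_neg_iff.2 (hg (OrderDual.toDual_le_toDual.2 hxy)))
    (by rw [show OrderDual.toDual (1 : L) = 1 from rfl, h1]; rfl)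
  have key : ∀ l : List L, firstSign (l.map (fun x => -g (OrderDual.toDual x))) =
      -firstSign (l.map (fun x => g (OrderDual.toDual x))) := fun l => by
    rw [← firstSign_map_neg, List.map_map]; rfl
  have nonneg : ∀ a : SignType, 0 ≤ -a ↔ a ≤ 0 := by decide
  have nonpos : ∀ a : SignType, -a ≤ 0 ↔ 0 ≤ a := by decide
  rw [key, key, SignType.neg_le_neg_iff] at a1 a2
  simp only [nonneg, nonpos] at a3 a4
  exact ⟨a1, a2, a4, a3⟩

/-- A compatible preorder on words which extends the order of letters, in which the letter `1` is
equivalent to the empty word and letters are idempotent, and which is finer than `SignLE`. -/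
structure WordOrder (R : List L → List L → Prop) : Prop where
  refl (w : List L) : R w w
  trans {u v w : List L} : R u v → R v w → R u w
  append {w w' v v' : List L} : R w w' → R v v' → R (w ++ v) (w' ++ v')
  of_le {x y : L} : x ≤ y → R [x] [y]
  one_le : R [1] []
  le_one : R [] [1]
  sq_le (x : L) : R [x, x] [x]
  le_sq (x : L) : R [x] [x, x]
  sign {w v : List L} : R w v → SignLE w v

namespace WordOrder

variable {R : List L → List L → Prop}

theorem reverse (S : WordOrder R) : WordOrder (fun w v : List L => R w.reverse v.reverse) where
  refl _ := S.refl _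
  trans := S.trans
  append h k := by simpa using S.append k h
  of_le h := by simpa using S.of_le h
  one_le := by simpa using S.one_le
  le_one := by simpa using S.le_one
  sq_le x := by simpa using S.sq_le x
  le_sq x := by simpa using S.le_sq x
  sign h := by simpa using (S.sign h).reverse

theorem dual (S : WordOrder R) : WordOrder (L := Lᵒᵈ) (fun w v => R v w) where
  refl _ := S.refl _
  trans h k := S.trans k h
  append h k := S.append h k
  of_le h := S.of_le h
  one_le := S.le_one
  le_one := S.one_le
  sq_le x := S.le_sq x
  le_sq x := S.sq_le x
  sign h := (S.sign h).dual

theorem cons (S : WordOrder R) (x : L) {w v : List L} (h : R w v) : R (x :: w) (x :: v) :=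
  S.append (S.refl [x]) h

/-- Every letter can be raised to `p`, and powers of `p` collapse. Nearly all inequalities below
come from this and its dual. -/
theorem le_singleton (S : WordOrder R) {p : L} (hp : 1 ≤ p) {w : List L} (h : ∀ x ∈ w, x ≤ p) :
    R w [p] := by
  induction w with
  | nil => exact S.trans S.le_one (S.of_le hp)
  | cons x w ih =>
    exact S.trans (S.append (S.of_le (h x (by simp))) (ih fun y hy => h y (by simp [hy])))
      (S.sq_le p)

theorem singleton_le (S : WordOrder R) {n : L} (hn : n ≤ 1) {w : List L} (h : ∀ x ∈ w, n ≤ x) :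
    R [n] w :=
  S.dual.le_singleton hn h

theorem nil_le (S : WordOrder R) {p : L} (hp : 1 ≤ p) : R [] [p] := S.le_singleton hp (by simp)

theorem le_cons (S : WordOrder R) {p : L} (hp : 1 ≤ p) (w : List L) : R w (p :: w) :=
  S.append (S.nil_le hp) (S.refl w)

theorem cons_le (S : WordOrder R) {n : L} (hn : n ≤ 1) (w : List L) : R (n :: w) w :=
  S.dual.le_cons hn w

/-! ### The shape of reduced words -/

theorem isReduced_tail (S : WordOrder R) {x : L} {w : List L} (h : IsReducedWord R (x :: w)) :
    IsReducedWord R w :=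
  fun w' h1 h2 => by simpa using h (x :: w') (S.cons x h1) (S.cons x h2)

theorem isReduced_ne_one (S : WordOrder R) {x : L} {w : List L} (h : IsReducedWord R (x :: w)) :
    x ≠ 1 := by
  rintro rfl
  simpa using h w (S.append S.one_le (S.refl w)) (S.append S.le_one (S.refl w))

/-- Two adjacent letters on the positive side are equivalent to the larger of them. -/
theorem not_isReduced_pos (S : WordOrder R) {x y : L} {w : List L} (hx : 1 ≤ x) (hy : 1 ≤ y) :
    ¬ IsReducedWord R (x :: y :: w) := by
  intro h
  have h1 : R [x, y] [max x y] := S.le_singleton (le_max_of_le_left hx) (by simp)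
  have h2 : R [max x y] [x, y] := by
    rcases max_choice x y with e | e <;> rw [e]
    · exact S.cons x (S.nil_le hy)
    · exact S.le_cons hx [y]
  simpa using h (max x y :: w) (S.append h1 (S.refl w)) (S.append h2 (S.refl w))

theorem isReduced_alternating (S : WordOrder R) {x y : L} {w : List L}
    (h : IsReducedWord R (x :: y :: w)) : x < 1 ∧ 1 < y ∨ y < 1 ∧ 1 < x := by
  have h1 := S.isReduced_ne_one h
  have h2 := S.isReduced_ne_one (S.isReduced_tail h)
  rcases lt_or_gt_of_ne h1 with a | a <;> rcases lt_or_gt_of_ne h2 with b | b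
  · exact absurd (IsReducedWord.dual h) (S.dual.not_isReduced_pos a.le b.le)
  · exact .inl ⟨a, b⟩
  · exact .inr ⟨b, a⟩
  · exact absurd h (S.not_isReduced_pos a.le b.le)

/-- A pair of letters nested between its neighbours can be removed from a word. -/
theorem isReduced_not_nested (S : WordOrder R) {a b c d : L} {w : List L} (ha : 1 < a)
    (hb : b < 1) (hc : 1 < c) (hd : d < 1) (h : IsReducedWord R (a :: b :: c :: d :: w))
    (hca : c ≤ a) : b < d := by
  by_contra hbd
  push Not at hbd
  -- If `d ≤ b`, then `abc ≤ a` and `d ≤ bcd`, so `abcd` is equivalent to the shorter `ad`.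
  have h1 : R [a, b, c, d] [a, d] :=
    S.append (w := [a, b, c]) (S.le_singleton ha.le (by simp [hca, (hb.trans ha).le])) (S.refl [d])
  have h2 : R [a, d] [a, b, c, d] :=
    S.cons a (S.singleton_le hd.le (by simp [hbd, (hd.trans hc).le]))
  have := h (a :: d :: w) (S.append h1 (S.refl w)) (S.append h2 (S.refl w))
  simp at this

/-- A reduced word that starts to narrow is contained in the interval between its first two
letters, and its last letter is innermost on its side. -/
theorem isReduced_narrow (S : WordOrder R) {a b c : L} {w : List L}
    (h : IsReducedWord R (a :: b :: c :: w)) (hac : a < 1 ∧ a < c ∨ 1 < a ∧ c < a) {z : L}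
    (hz : z ∈ (a :: b :: c :: w).getLast?) :
    (∀ x ∈ a :: b :: c :: w, min a b ≤ x ∧ x ≤ max a b) ∧
    (z < 1 → ∀ x ∈ a :: b :: c :: w, x < 1 → x ≤ z) ∧
    (1 < z → ∀ x ∈ a :: b :: c :: w, 1 < x → z ≤ x) := by
  induction w generalizing a b c with
  | nil =>
    have h1 := S.isReduced_alternating h
    have h2 := S.isReduced_alternating (S.isReduced_tail h)
    simp at hz
    subst hz
    simp only [List.mem_cons, List.not_mem_nil, or_false]
    grind
  | cons d w ih =>
    have h1 := S.isReduced_alternating h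
    have h2 := S.isReduced_alternating (S.isReduced_tail h)
    have h3 := S.isReduced_alternating (S.isReduced_tail (S.isReduced_tail h))
    have hbd : b < 1 ∧ b < d ∨ 1 < b ∧ d < b := by
      rcases hac with ⟨ha, hac⟩ | ⟨ha, hac⟩
      · have hb : 1 < b := by grind
        have hc : c < 1 := by grind
        have hd : 1 < d := by grind
        exact .inr ⟨hb, S.dual.isReduced_not_nested (a := a) (c := c) ha hb hc hd
          (IsReducedWord.dual h) hac.le⟩
      · have hb : b < 1 := by grind
        exact .inl ⟨hb, S.isReduced_not_nested ha hb (by grind) (by grind) h hac.le⟩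
    have hz' : z ∈ (b :: c :: d :: w).getLast? := by simpa using hz
    obtain ⟨k1, k2, k3⟩ := ih (S.isReduced_tail h) hbd hz'
    have kc := fun e : z < 1 => k2 e c (by simp)
    have kc' := fun e : 1 < z => k3 e c (by simp)
    refine ⟨fun x hx => ?_, fun e x hx => ?_, fun e x hx => ?_⟩
    · rcases List.mem_cons.1 hx with rfl | hx
      · simp
      · have := k1 x hx
        grind
    · rcases List.mem_cons.1 hx with rfl | hx
      · grind
      · exact k2 e x hx
    · rcases List.mem_cons.1 hx with rfl | hx
      · grind
      · exact k3 e x hx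

end WordOrder

theorem intervalSign_one {s t : L} (hs : s ≤ 1) (ht : 1 ≤ t) : intervalSign s t 1 = 0 := by
  simp [intervalSign, hs.not_gt, ht.not_gt]

/-! ### Sign comparison implies the order, for reduced words -/

namespace WordOrder

variable {R : List L → List L → Prop}

/-- A leading positive letter `l` only enlarges the word, so induction gives `w ≤ v`. The sign tests
force the first letter `m` of `v` to satisfy `l ≤ m`, whence `lw ≤ lv ≤ v`, as `m` absorbs `l`. -/
theorem le_of_signLE_pos_cons (S : WordOrder R) {l : L} {w v : List L} (hl : 1 < l)
    (hv : IsReducedWord R v) (hA : SignLE (l :: w) v) (ih : SignLE w v → R w v) : R (l :: w) v := by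
  have hwv : R w v := ih ((S.sign (S.le_cons hl.le w)).trans hA)
  have key : ∀ t, 1 ≤ t → t < l → 1 ≤ firstSign (v.map (intervalSign 1 t)) := fun t h1 h2 => by
    have := (hA _ (intervalSign_monotone h1) (intervalSign_one le_rfl h1)).1
    simpa [firstSign, intervalSign, h2, hl.not_gt] using this
  cases v with
  | nil => exact absurd (key 1 le_rfl hl) (by simp [firstSign])
  | cons m v =>
    by_cases hlm : l ≤ m
    · refine S.trans (S.cons l hwv) ?_
      exact S.append (w := [l, m]) (S.le_singleton (hl.le.trans hlm) (by simp [hlm])) (S.refl v)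
    · push Not at hlm
      exfalso
      rcases lt_or_gt_of_ne (S.isReduced_ne_one hv) with hm | hm
      · have := key 1 le_rfl hl
        simp only [List.map_cons, firstSign, intervalSign, hm, if_true] at this
        exact absurd this (by rw [if_neg (by decide)]; decide)
      · have := key m hm.le hlm
        cases v with
        | nil => simp [firstSign, intervalSign, hm.not_gt] at this
        | cons m₂ v =>
          have hm₂ : m₂ < 1 := by
            have := S.isReduced_alternating hv
            grind
          simp only [List.map_cons, firstSign, intervalSign, hm.not_gt, lt_irrefl, hm₂, if_true,
            if_false] at this
          exact absurd this (by rw [if_neg (by decide)]; decide)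

theorem le_of_signLE_cons_cons (S : WordOrder R) {l l₂ l₃ z m : L} {w v : List L} (hl : l < 1)
    (hm : 1 < m) (hw : IsReducedWord R (l :: l₂ :: l₃ :: w))
    (hz : z ∈ (l :: l₂ :: l₃ :: w).getLast?) (hz1 : z < 1)
    (hA : SignLE (l :: l₂ :: l₃ :: w) (m :: v)) (hlm : l₂ ≤ m)
    (ih : SignLE (l₃ :: w) (m :: v) → R (l₃ :: w) (m :: v)) :
    R (l :: l₂ :: l₃ :: w) (m :: v) ∨
      (∀ x ∈ l :: l₂ :: l₃ :: w, x ≤ m) ∧ (∃ x ∈ l :: l₂ :: l₃ :: w, x < 1 ∧ l < x) ∧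
        ∀ x ∈ l :: l₂ :: l₃ :: w, x < 1 → x ≤ z := by
  have h1 := S.isReduced_alternating hw
  have h2 := S.isReduced_alternating (S.isReduced_tail hw)
  have hl₂ : 1 < l₂ := by grind
  have hl₃ : l₃ < 1 := by grind
  -- If `l₃ ≤ l`, then `l₃ ≤ l l₂ l₃`, so induction applies after dropping `l l₂`; these are put
  -- back because `l` only lowers a word and `m` absorbs `l₂`. Otherwise the word narrows from its
  -- start.
  by_cases hll : l₃ ≤ l
  · left
    have k : R [l₃] [l, l₂, l₃] := S.singleton_le hl₃.le (by simp [hll, (hl₃.trans hl₂).le])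
    have k' := ih ((S.sign (S.append k (S.refl w))).trans hA)
    refine S.trans (S.cons_le hl.le _) (S.trans (S.cons l₂ k') ?_)
    exact S.append (w := [l₂, m]) (S.le_singleton hm.le (by simp [hlm])) (S.refl v)
  · right
    push Not at hll
    obtain ⟨k1, k2, -⟩ := S.isReduced_narrow hw (.inl ⟨hl, hll⟩) hz
    refine ⟨fun x hx => ?_, ⟨l₃, by simp, hl₃, hll⟩, k2 hz1⟩
    have := (k1 x hx).2
    grind

/-- Comparing the beginnings of a word `w` with negative ends and a word `v` with positive ends. -/
theorem le_or_bounds_of_signLE (S : WordOrder R) {l l' m m' : L} {w v : List L}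
    (hw : IsReducedWord R w) (hv : IsReducedWord R v) (hA : SignLE w v)
    (ih : ∀ w' v', w'.length + v'.length < w.length + v.length → SignLE w' v' → R w' v')
    (hwl : 2 ≤ w.length) (hvl : 2 ≤ v.length)
    (hl : l ∈ w.head?) (hl' : l' ∈ w.getLast?) (hm : m ∈ v.head?) (hm' : m' ∈ v.getLast?)
    (hl1 : l < 1) (hl1' : l' < 1) (hm1 : 1 < m) (hm1' : 1 < m') :
    R w v ∨
    ((∀ x ∈ w, x ≤ m) ∧ (∃ x ∈ w, x < 1 ∧ l < x) ∧ ∀ x ∈ w, x < 1 → x ≤ l') ∨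
    ((∀ x ∈ v, l ≤ x) ∧ (∃ x ∈ v, 1 < x ∧ x < m) ∧ ∀ x ∈ v, 1 < x → m' ≤ x) := by
  match w, v, hwl, hvl with
  | [a, b], _, _, _ =>
    have := S.isReduced_alternating hw
    simp at hl hl'
    grind
  | _, [a, b], _, _ =>
    have := S.isReduced_alternating hv
    simp at hm hm'
    grind
  | a :: l₂ :: l₃ :: w, b :: m₂ :: m₃ :: v, _, _ =>
    simp only [List.head?_cons, Option.mem_def, Option.some.injEq] at hl hm
    subst hl hm
    have h1 := S.isReduced_alternating hw
    have h2 := S.isReduced_alternating hv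
    by_cases hlm : l₂ ≤ b
    · rcases S.le_of_signLE_cons_cons hl1 hm1 hw hl' hl1' hA hlm
        (ih _ _ (by simp)) with h | h
      · exact .inl h
      · exact .inr (.inl h)
    -- The interval between the two first letters hides both, so the second letters decide: `l₂`
    -- above it and `m₂` below it would contradict the comparison of first signs.
    · have hlm' : a ≤ m₂ := by
        by_contra hlm'
        push Not at hlm hlm'
        have := (hA _ (intervalSign_monotone (hl1.trans hm1).le)
          (intervalSign_one hl1.le hm1.le)).1
        simp [firstSign, intervalSign, hlm, hlm', (hl1.trans hm1).not_gt,
          show ¬ l₂ < a by grind] at this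
      rcases S.dual.le_of_signLE_cons_cons (l := b) (l₂ := m₂) (l₃ := m₃) (m := a) hm1 hl1
        (IsReducedWord.dual hv) hm' hm1' hA.dual hlm'
        (fun h => ih (a :: l₂ :: l₃ :: w) (m₃ :: v) (by simp) h.dual) with h | h
      · exact .inl h
      · exact .inr (.inr h)

/-- If the letters of `w` are at most the first letter `m` of `v`, and those of `v` are at least
the last letter `l` of `w`, then `w ≤ m l ≤ v`. -/
theorem le_of_bounds (S : WordOrder R) {l m : L} {w v : List L} (hl : l ∈ w.getLast?)
    (hm : m ∈ v.head?) (hl1 : l < 1) (hm1 : 1 < m) (hw : ∀ x ∈ w, x ≤ m) (hv : ∀ x ∈ v, l ≤ x) :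
    R w v := by
  obtain ⟨w, rfl⟩ := List.getLast?_eq_some_iff.1 hl
  obtain ⟨v, rfl⟩ := List.head?_eq_some_iff.1 hm
  refine S.trans (v := [m, l]) ?_ ?_
  · exact S.append (S.le_singleton hm1.le fun x hx => hw x (by simp [hx])) (S.refl [l])
  · exact S.cons m (S.singleton_le hl1.le fun x hx => hv x (by simp [hx]))

/-- A word that is trivial or a single negative letter is below all words above it in `SignLE`. -/
theorem le_of_signLE_singleton (S : WordOrder R) {l : L} {v : List L} (hl : l ≤ 1)
    (hA : SignLE [l] v) : R [l] v := by
  refine S.singleton_le hl fun x hx => ?_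
  -- The interval `[l, 1]` gives `l` no negative sign, so no letter of `v` may lie below `l`.
  have := (hA _ (intervalSign_monotone hl) (intervalSign_one hl le_rfl)).2.2.1
    (by simp [intervalSign, hl.not_gt]) x hx
  by_contra h
  push Not at h
  simp only [intervalSign, h, if_true] at this
  revert this; decide

theorem le_of_signLE_length (S : WordOrder R) {w v : List L} (hw : w.length < 2)
    (h : ∀ l ∈ w.head?, l < 1) (hA : SignLE w v) : R w v := by
  match w, hw with
  | [], _ =>
    exact S.trans S.le_one (S.le_of_signLE_singleton le_rfl ((S.sign S.one_le).trans hA))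
  | [l], _ => exact S.le_of_signLE_singleton (h l (by simp)).le hA

theorem le_of_signLE_head (S : WordOrder R) {l : L} {w v : List L} (h : l ∈ w.head?) (hl : 1 < l)
    (hv : IsReducedWord R v) (hA : SignLE w v)
    (ih : ∀ w' v', w'.length + v'.length < w.length + v.length → SignLE w' v' → R w' v') :
    R w v := by
  obtain ⟨w, rfl⟩ := List.head?_eq_some_iff.1 h
  exact S.le_of_signLE_pos_cons hl hv hA (ih _ _ (by simp))

theorem isReduced_head_ne_one (S : WordOrder R) {w : List L} (h : IsReducedWord R w) :
    ∀ l ∈ w.head?, l ≠ 1 := by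
  intro l hl
  obtain ⟨w, rfl⟩ := List.head?_eq_some_iff.1 hl
  exact S.isReduced_ne_one h

theorem isReduced_getLast_ne_one (S : WordOrder R) {w : List L} (h : IsReducedWord R w) :
    ∀ l ∈ w.getLast?, l ≠ 1 := by
  have := S.reverse.isReduced_head_ne_one (IsReducedWord.reverse h)
  simpa using this

/-- Reversal and duality turn one end-letter argument into four. What survives is `w` with negative
ends and `v` with positive ends, where `le_or_bounds_of_signLE` is used from the left and from the
right. -/
theorem le_of_signLE_isReduced (S : WordOrder R) {w v : List L} (hw : IsReducedWord R w)
    (hv : IsReducedWord R v) (hA : SignLE w v)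
    (ih : ∀ w' v', w'.length + v'.length < w.length + v.length → SignLE w' v' → R w' v') :
    R w v := by
  have ihr : ∀ w' v' : List L, w'.length + v'.length < w.reverse.length + v.reverse.length →
      SignLE w' v' → R w'.reverse v'.reverse := fun w' v' h k =>
    ih _ _ (by simpa using h) k.reverse
  have toR : R w.reverse.reverse v.reverse.reverse → R w v := by simp
  have hw' := IsReducedWord.reverse hw
  have hv' := IsReducedWord.reverse hv
  by_cases c1 : ∃ l ∈ w.head?, 1 < l
  · obtain ⟨l, h, hl⟩ := c1
    exact S.le_of_signLE_head h hl hv hA ih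
  by_cases c2 : ∃ l ∈ w.getLast?, 1 < l
  · obtain ⟨l, h, hl⟩ := c2
    exact toR (S.reverse.le_of_signLE_head (by simpa using h) hl hv' hA.reverse ihr)
  by_cases c3 : ∃ m ∈ v.head?, m < 1
  · obtain ⟨m, h, hm⟩ := c3
    exact S.dual.le_of_signLE_head (l := m) h hm (IsReducedWord.dual hw) hA.dual
      fun w' v' k e => ih _ _ (by rw [add_comm, add_comm w.length]; exact k) e.dual
  by_cases c4 : ∃ m ∈ v.getLast?, m < 1
  · obtain ⟨m, h, hm⟩ := c4
    refine toR (S.reverse.dual.le_of_signLE_head (l := m) (w := v.reverse) (v := w.reverse)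
      (List.head?_reverse.trans h) hm (IsReducedWord.dual hw') hA.reverse.dual
      fun w' v' k e => ihr _ _ ?_ e.dual)
    rw [add_comm, add_comm w.reverse.length]; exact k
  push Not at c1 c2 c3 c4
  have d1 : ∀ l ∈ w.head?, l < 1 := fun l h =>
    lt_of_le_of_ne (c1 l h) (S.isReduced_head_ne_one hw l h)
  have d2 : ∀ l ∈ w.getLast?, l < 1 := fun l h =>
    lt_of_le_of_ne (c2 l h) (S.isReduced_getLast_ne_one hw l h)
  have d3 : ∀ m ∈ v.head?, 1 < m := fun m h =>
    lt_of_le_of_ne (c3 m h) (S.isReduced_head_ne_one hv m h).symm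
  have d4 : ∀ m ∈ v.getLast?, 1 < m := fun m h =>
    lt_of_le_of_ne (c4 m h) (S.isReduced_getLast_ne_one hv m h).symm
  by_cases hwl : w.length < 2
  · exact S.le_of_signLE_length hwl d1 hA
  by_cases hvl : v.length < 2
  · exact S.dual.le_of_signLE_length (w := v) (v := w) hvl d3 hA.dual
  push Not at hwl hvl
  have hw0 : w ≠ [] := by rintro rfl; simp at hwl
  have hv0 : v ≠ [] := by rintro rfl; simp at hvl
  have e1 : w.head hw0 ∈ w.head? := List.head?_eq_some_head hw0
  have e2 : w.getLast hw0 ∈ w.getLast? := List.getLast?_eq_some_getLast hw0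
  have e3 : v.head hv0 ∈ v.head? := List.head?_eq_some_head hv0
  have e4 : v.getLast hv0 ∈ v.getLast? := List.getLast?_eq_some_getLast hv0
  generalize w.head hw0 = l at e1
  generalize w.getLast hw0 = l' at e2
  generalize v.head hv0 = m at e3
  generalize v.getLast hv0 = m' at e4
  have left := S.le_or_bounds_of_signLE hw hv hA ih hwl hvl e1 e2 e3 e4 (d1 _ e1) (d2 _ e2)
    (d3 _ e3) (d4 _ e4)
  have right := S.reverse.le_or_bounds_of_signLE (l := l') (l' := l) (m := m') (m' := m) hw' hv'
    hA.reverse ihr (by simpa using hwl) (by simpa using hvl) (by simpa using e2)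
    (by simpa using e1) (by simpa using e4) (by simpa using e3) (d2 _ e2) (d1 _ e1) (d4 _ e4)
    (d3 _ e3)
  simp only [List.mem_reverse] at right
  -- The same word cannot narrow from both sides: its last letter would be innermost while some
  -- letter lies strictly further in than its first, and conversely. So the bounds concern different
  -- words, and `le_of_bounds` applies.
  rcases left with h | ⟨h1, ⟨x, hx, hx1, hlx⟩, -⟩ | ⟨h1, ⟨x, hx, hx1, hlx⟩, -⟩
  · exact h
  · rcases right with k | ⟨-, -, k⟩ | ⟨k, -⟩
    · exact toR k
    · exact absurd (k x hx hx1) hlx.not_ge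
    · exact S.le_of_bounds e2 e3 (d2 _ e2) (d3 _ e3) h1 k
  · rcases right with k | ⟨k, -⟩ | ⟨-, -, k⟩
    · exact toR k
    · exact toR (S.reverse.le_of_bounds (l := l) (m := m') (by simpa using e1)
        (by simpa using e4) (d1 _ e1) (d4 _ e4) (by simpa using k) (by simpa using h1))
    · exact absurd (k x hx hx1) hlx.not_ge

/-- All word orders coincide with the comparison by signs. -/
theorem le_of_signLE (S : WordOrder R) (w v : List L) (hA : SignLE w v) : R w v := by
  induction hn : w.length + v.length using Nat.strong_induction_on generalizing w v with
  | _ n ih =>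
    subst hn
    by_cases hw : IsReducedWord R w
    · by_cases hv : IsReducedWord R v
      · exact S.le_of_signLE_isReduced hw hv hA fun w' v' h k => ih _ h w' v' k rfl
      · simp only [IsReducedWord, not_forall, not_le] at hv
        obtain ⟨v', h1, h2, h3⟩ := hv
        exact S.trans (ih _ (by omega) w v' (hA.trans (S.sign h1)) rfl) h2
    · simp only [IsReducedWord, not_forall, not_le] at hw
      obtain ⟨w', h1, h2, h3⟩ := hw
      exact S.trans h1 (ih _ (by omega) w' v ((S.sign h2).trans hA) rfl)

end WordOrder

end WordOrder

/-! ### Transfer to the free Kuratowski monoid -/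

namespace FK

section
variable {L : Type u} [LinearOrder L] [One L]

theorem mk_eq_ι_mul_prod (x : L) (w : List L) : mk ⟨x, w⟩ = ι x * (w.map ι).prod := by
  induction w generalizing x with
  | nil => rw [List.map_nil, List.prod_nil, mul_one]; rfl
  | cons y w ih =>
    rw [List.map_cons, List.prod_cons, ← ih]
    rfl

theorem prod_eq_mk (w : List L) : (w.map ι).prod = mk ⟨1, w⟩ := by
  rw [mk_eq_ι_mul_prod, ι_one, one_mul]

theorem exists_eq_prod (x : FK L) : ∃ w : List L, x = (w.map ι).prod := by
  induction x using Quotient.inductionOn with | h a => ?_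
  exact ⟨a.head :: a.tail, mk_eq_ι_mul_prod a.head a.tail⟩

theorem signLE_of_wordLE {a b : FreeSemigroup L} (h : WordLE L a b) :
    SignLE (a.head :: a.tail) (b.head :: b.tail) := by
  induction h with
  | of_le h =>
    intro g hg _
    have := hg h
    simp only [FreeSemigroup.of, List.map_cons, List.map_nil, List.reverse_singleton, firstSign,
      List.mem_singleton, forall_eq]
    refine ⟨?_, ?_, this.trans', this.trans⟩ <;> split_ifs <;> simp_all
  | le_mul_one x =>
    intro g _ h1
    by_cases e : g x = 0 <;> simp [firstSign, h1, e]
  | le_one_mul x =>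
    intro g _ h1
    by_cases e : g x = 0 <;> simp [firstSign, h1, e]
  | mul_one_le x =>
    intro g _ h1
    by_cases e : g x = 0 <;> simp [firstSign, h1, e]
  | one_mul_le x =>
    intro g _ h1
    by_cases e : g x = 0 <;> simp [firstSign, h1, e]
  | le_sq x =>
    intro g _ h1
    by_cases e : g x = 0 <;> simp [firstSign, e]
  | sq_le x =>
    intro g _ h1
    by_cases e : g x = 0 <;> simp [firstSign, e]
  | refl a => exact .refl _
  | trans _ _ ih ih' => exact ih.trans ih'
  | mul_right c _ ih => exact ih.append (.refl (c.head :: c.tail))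
  | mul_left c _ ih => exact (SignLE.refl (c.head :: c.tail)).append ih

theorem ι_mul_ι_self (x : L) : ι x * ι x = ι x := mk_eq_mk.2 ⟨.sq_le x, .le_sq x⟩

theorem wordOrder : WordOrder (fun w v : List L => (w.map ι).prod ≤ (v.map ι).prod) where
  refl _ := le_rfl
  trans := le_trans
  append h k := by simpa using mul_le_mul_both h k
  of_le h := by simpa [ι] using mk_le_mk.2 (WordLE.of_le h)
  one_le := by simp [ι_one]
  le_one := by simp [ι_one]
  sq_le x := by simp [ι_mul_ι_self]
  le_sq x := by simp [ι_mul_ι_self]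
  sign {w v} h := by
    rw [prod_eq_mk, prod_eq_mk, mk_le_mk] at h
    -- Lists may be empty while semigroup words may not; the padding letter `1` bridges this and is
    -- invisible to signs.
    have h1 : SignLE w (1 :: w) := fun g _ h1 => by
      by_cases e : firstSign (w.map g).reverse = 0 <;> simp [firstSign, firstSign_append, h1, e]
    have h2 : SignLE (1 :: v) v := fun g _ h1 => by
      by_cases e : firstSign (v.map g).reverse = 0 <;> simp [firstSign, firstSign_append, h1, e]
    exact h1.trans ((signLE_of_wordLE h).trans h2)

end

section
variable {L : Type u} {M : Type v} [LinearOrder L] [One L] [LinearOrder M] [One M]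

/-- The morphism sending the letters of sign `-1`, `0`, `1` to `a`, `1`, `b`. -/
def signHom {a b : M} (ha : a < 1) (hb : 1 < b) (g : L → SignType) (hg : Monotone g)
    (h1 : g 1 = 0) : PointedHom L M where
  toFun x := if g x < 0 then a else if 0 < g x then b else 1
  monotone' x y hxy := by
    have := hg hxy
    dsimp only
    have hab := ha.trans hb
    split_ifs <;> order
  map_one' := by simp [h1]

theorem map_prod (f : PointedHom L M) (w : List L) :
    map f (w.map ι).prod = ((w.map f.toFun).map ι).prod := by
  rw [map_list_prod, List.map_map, List.map_map]
  rfl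

/-- The order of `FK L` is determined by the morphisms from `L` to any pointed linearly ordered
set that has both a negative and a positive element. -/
theorem le_of_forall_map_le {a b : M} (ha : a < 1) (hb : 1 < b) {x y : FK L}
    (h : ∀ f : PointedHom L M, map f x ≤ map f y) : x ≤ y := by
  obtain ⟨w, rfl⟩ := exists_eq_prod x
  obtain ⟨v, rfl⟩ := exists_eq_prod y
  refine wordOrder.le_of_signLE w v fun g hg h1 => ?_
  have k := h (signHom ha hb g hg h1)
  rw [map_prod, map_prod] at k
  have k' := wordOrder.sign k (intervalSign 1 1) (intervalSign_monotone le_rfl)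
    (intervalSign_one le_rfl le_rfl)
  -- The signs of the letters of `M` relative to `1` recover `g`, so the comparison in `FK M`
  -- returns the clause for `g`.
  have e : ∀ x, intervalSign 1 1 ((signHom ha hb g hg h1).toFun x) = g x := by
    intro x
    dsimp only [signHom, intervalSign]
    cases hx : g x
    · simp
    · simp [ha]
    · simp [hb, hb.not_gt]
  simpa [Function.comp_def, e, ← List.map_reverse] using k'

theorem exists_map_ne {a b : M} (ha : a < 1) (hb : 1 < b) {x y : FK L} (h : x ≠ y) :
    ∃ f : PointedHom L M, map f x ≠ map f y := by
  by_contra! k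
  exact h (le_antisymm (le_of_forall_map_le ha hb fun f => (k f).le)
    (le_of_forall_map_le ha hb fun f => (k f).ge))

theorem exists_map_le_imp {a b : M} (ha : a < 1) (hb : 1 < b) (x y : FK L) :
    ∃ f : PointedHom L M, map f x ≤ map f y → x ≤ y := by
  by_cases h : x ≤ y
  -- Any morphism serves here; the constant one always exists.
  · exact ⟨signHom ha hb (fun _ => 0) (fun _ _ _ => le_rfl) rfl, fun _ => h⟩
  · by_contra! k
    exact h (le_of_forall_map_le ha hb fun f => (k f).1)

end

end FK

/-! ### Separation and embedding into powers -/

theorem HasType.exists_lt_one {L : Type u} [LinearOrder L] [One L] {n p : ℕ} (h : HasType L n p)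
    (hn : n ≠ 0) : ∃ a : L, a < 1 := by
  have : {x : L | x < 1}.Nonempty := by
    rw [← Set.encard_ne_zero, h.1]
    exact_mod_cast hn
  exact this

theorem HasType.exists_one_lt {L : Type u} [LinearOrder L] [One L] {n p : ℕ} (h : HasType L n p)
    (hp : p ≠ 0) : ∃ a : L, 1 < a := by
  have : {x : L | 1 < x}.Nonempty := by
    rw [← Set.encard_ne_zero, h.2]
    exact_mod_cast hp
  exact this

theorem injective_of_le_iff_le {α β : Type*} [PartialOrder α] [PartialOrder β] {f : α → β}
    (h : ∀ x y, f x ≤ f y ↔ x ≤ y) : Function.Injective f :=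
  fun x y e => le_antisymm ((h x y).1 e.le) ((h y x).1 e.ge)

theorem mainTheorem9 {L : Type u} [LinearOrder L] [One L]
    {L₁₂ : Type v} [LinearOrder L₁₂] [One L₁₂] (h₁₂ : HasType L₁₂ 1 2)
    {L₂₁ : Type v} [LinearOrder L₂₁] [One L₂₁] (h₂₁ : HasType L₂₁ 2 1)
    {L₂₂ : Type v} [LinearOrder L₂₂] [One L₂₂] (h₂₂ : HasType L₂₂ 2 2) :
    -- separation by morphisms into `L₁₂` or `L₂₁`
    (∀ x y : FK L, x ≠ y →
      (∃ f : PointedHom L L₁₂, FK.map f x ≠ FK.map f y) ∨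
      (∃ f : PointedHom L L₂₁, FK.map f x ≠ FK.map f y)) ∧
    -- embedding of partially ordered monoids into a power of `FK L₁₂ × FK L₂₁`
    (∃ (I : Type u) (Φ : FK L →* (I → FK L₁₂ × FK L₂₁)),
      Function.Injective Φ ∧ ∀ x y : FK L, Φ x ≤ Φ y ↔ x ≤ y) ∧
    -- separation by morphisms into `L₂₂`
    (∀ x y : FK L, x ≠ y → ∃ f : PointedHom L L₂₂, FK.map f x ≠ FK.map f y) ∧
    -- embedding of partially ordered monoids into a power of `FK L₂₂`
    (∃ (I : Type u) (Φ : FK L →* (I → FK L₂₂)),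
      Function.Injective Φ ∧ ∀ x y : FK L, Φ x ≤ Φ y ↔ x ≤ y) := by
  obtain ⟨a, ha⟩ := h₁₂.exists_lt_one (by norm_num)
  obtain ⟨b, hb⟩ := h₁₂.exists_one_lt (by norm_num)
  obtain ⟨a', ha'⟩ := h₂₁.exists_lt_one (by norm_num)
  obtain ⟨b', hb'⟩ := h₂₁.exists_one_lt (by norm_num)
  obtain ⟨c, hc⟩ := h₂₂.exists_lt_one (by norm_num)
  obtain ⟨d, hd⟩ := h₂₂.exists_one_lt (by norm_num)
  refine ⟨fun x y h => .inl (FK.exists_map_ne ha hb h), ?_,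
    fun x y h => FK.exists_map_ne hc hd h, ?_⟩
  · choose f hf using FK.exists_map_le_imp (L := L) ha hb
    choose g hg using FK.exists_map_le_imp (L := L) ha' hb'
    -- One coordinate per pair `(x, y)`: its morphisms reflect the inequality `x ≤ y`, so the family
    -- reflects the whole order, and injectivity follows.
    let Φ : FK L →* (FK L × FK L → FK L₁₂ × FK L₂₁) :=
      MonoidHom.pi fun i => (FK.map (f i.1 i.2)).prod (FK.map (g i.1 i.2))
    have hΦ : ∀ x y : FK L, Φ x ≤ Φ y ↔ x ≤ y := fun x y =>
      ⟨fun h => hf x y (h (x, y)).1, fun h i => ⟨FK.map_monotone _ h, FK.map_monotone _ h⟩⟩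
    exact ⟨_, Φ, injective_of_le_iff_le hΦ, hΦ⟩
  · choose f hf using FK.exists_map_le_imp (L := L) hc hd
    let Φ : FK L →* (FK L × FK L → FK L₂₂) := MonoidHom.pi fun i => FK.map (f i.1 i.2)
    have hΦ : ∀ x y : FK L, Φ x ≤ Φ y ↔ x ≤ y := fun x y =>
      ⟨fun h => hf x y (h (x, y)), fun h i => FK.map_monotone _ h⟩
    exact ⟨_, Φ, injective_of_le_iff_le hΦ, hΦ⟩
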